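/- Let $L/K$ be a finite separable extension of fields with Galois closure $E$, let $G=\mathrm{Gal}(E/K)$, $G_L=\mathrm{Gal}(E/L)$, let $X=G/G_L$ be the left coset space, and let $\lambda:G\to\mathrm{Perm}(X)$, $\lambda(\sigma)(\tau G_L)=\sigma\tau G_L$. Let $N$ be a group and let $\alpha_1,\alpha_2:N\hookrightarrow\mathrm{Perm}(X)$ be injective homomorphisms whose images are regular (of the same size as $X$ and transitive on $X$) and normalized by $\lambda(G)$. For $i=1,2$ let $E[\alpha_i(N)]^G$ be the $K$-Hopf algebra of fixed points of the group algebra $E[\alpha_i(N)]$ under the simultaneous action of $G$ on $E$ as Galois automorphisms and on $\alpha_i(N)$ by $\sigma*\eta=\lambda(\sigma)\eta\lambda(\sigma)^{-1}$. Let $\mathrm{Hol}(N)$ be the normalizer in $\mathrm{Perm}(N)$ of the left regular image of $N$; it equals $\rho(N)\rtimes\mathrm{Aut}(N)$, where $\rho(n)(x)=xn^{-1}$. Let $\beta_i:G\hookrightarrow\mathrm{Hol}(N)$ be the embedding corresponding to $\alpha_i$ under Byott's translation, that is, $\beta_i(\sigma)=a_i^{-1}\circ\lambda(\sigma)\circ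 a_i$, where $a_i:N\to X$ is the bijection $a_i(\eta)=\alpha_i(\eta)(G_L)$, and let $\overline{\beta_i}:G\to\mathrm{Aut}(N)$ be the composition of $\beta_i$ with the projection of $\rho(N)\rtimes\mathrm{Aut}(N)$ onto $\mathrm{Aut}(N)$. Then: (1) $E[\alpha_1(N)]^G\cong E[\alpha_2(N)]^G$ as $K$-Hopf algebras if and only if there exists $\mu\in\mathrm{Aut}(N)$ such that $\overline{\beta_2}(g)=\mu\,\overline{\beta_1}(g)\,\mu^{-1}$ for all $g\in G$. (2) If $\mathrm{Aut}(N)$ is abelian (in particular, if $N$ is cyclic), then $E[\alpha_1(N)]^G\cong E[\alpha_2(N)]^G$ as $K$-Hopf algebras if and only if $\overline{\beta_1}(g)=\overline{\beta_2}(g)$ for all $g\in G$. -/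

import Mathlib

noncomputable section

open scoped TensorProduct

namespace HopfGalois

section Descent

universe u

variable {K E : Type*} {A : Type u} [Field K] [Field E] [Algebra K E] [Ring A] [HopfAlgebra E A]
  [Algebra K A] [IsScalarTower K E A]

/-- The canonical map `H ⊗[K] H → A ⊗[E] A`. -/
def tensorIncl (H : Subalgebra K A) : H ⊗[K] H →ₐ[K] A ⊗[E] A :=
  (Algebra.TensorProduct.mapOfCompatibleSMul E K K A A).comp
    (Algebra.TensorProduct.map H.val H.val)

@[simp] theorem tensorIncl_tmul (H : Subalgebra K A) (x y : H) :
    tensorIncl (E := E) H (x ⊗ₜ y) = (x : A) ⊗ₜ (y : A) := rfl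

/-- The canonical map `H ⊗[K] (H ⊗[K] H) → A ⊗[E] (A ⊗[E] A)`. -/
def tensorIncl₃ (H : Subalgebra K A) : H ⊗[K] (H ⊗[K] H) →ₐ[K] A ⊗[E] (A ⊗[E] A) :=
  (Algebra.TensorProduct.mapOfCompatibleSMul E K K A (A ⊗[E] A)).comp
    (Algebra.TensorProduct.map H.val (tensorIncl (E := E) H))

@[simp] theorem tensorIncl₃_tmul (H : Subalgebra K A) (x : H) (y : H ⊗[K] H) :
    tensorIncl₃ (E := E) H (x ⊗ₜ y) = (x : A) ⊗ₜ tensorIncl H y := rfl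

/-- A `K`-subalgebra `H` of an `E`-Hopf algebra `A` to which the Hopf algebra structure of `A`
restricts: `K`-linearly independent elements of `H` are `E`-linearly independent in `A`, and
`Δ`, `ε` and `S` restrict to `H`. -/
structure IsHopfForm (E : Type*) [Field E] [Algebra K E] [HopfAlgebra E A]
    [IsScalarTower K E A] (H : Subalgebra K A) : Prop where
  linInd : ∀ (ι : Type u) (v : ι → H), LinearIndependent K v →
    LinearIndependent E (fun i => (v i : A))
  comul_mem : ∀ h ∈ H, Coalgebra.comul (R := E) h ∈ (tensorIncl (E := E) H).range
  counit_mem : ∀ h ∈ H, Coalgebra.counit (R := E) h ∈ (Algebra.ofId K E).range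
  antipode_mem : ∀ h ∈ H, HopfAlgebra.antipode E h ∈ H

variable {H : Subalgebra K A}

theorem injective_of_basis {ι U V : Type*} [AddCommGroup U] [Module K U] [AddCommGroup V]
    [Module K V] [Module E V] [IsScalarTower K E V] (b : Module.Basis ι K U) (f : U →ₗ[K] V)
    (h : LinearIndependent E (fun i => f (b i))) : Function.Injective f := by
  have h' : LinearIndependent K (fun i => f (b i)) := by
    refine LinearIndependent.restrict_scalars (R := K) (K := E) ?_ h
    intro x y hxy
    simpa [Algebra.smul_def] using hxy
  rw [← LinearMap.ker_eq_bot, LinearMap.ker_eq_bot']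
  intro m hm
  have hb : f m = ∑ i ∈ (b.repr m).support, b.repr m i • f (b i) := by
    conv_lhs => rw [← b.linearCombination_repr m]
    simp [Finsupp.linearCombination_apply, Finsupp.sum, map_sum]
  rw [hm] at hb
  have := linearIndependent_iff'.1 h' _ _ hb.symm
  apply b.repr.injective
  ext i
  by_cases hi : i ∈ (b.repr m).support
  · simpa using this i hi
  · simpa using hi

theorem IsHopfForm.linInd₂ (hH : IsHopfForm E H) {ι : Type u} (b : Module.Basis ι K H) :
    LinearIndependent E (fun p : ι × ι => tensorIncl (E := E) H ((b.tensorProduct b) p)) := by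
  have := hH.linInd ι b b.linearIndependent
  simpa [Module.Basis.tensorProduct_apply'] using LinearIndependent.tmul_of_flat_right this this

theorem IsHopfForm.injective₂ (hH : IsHopfForm E H) :
    Function.Injective (tensorIncl (E := E) H) :=
  injective_of_basis (E := E) _ (tensorIncl (E := E) H).toLinearMap
    (hH.linInd₂ (Module.Basis.ofVectorSpace K H))

theorem IsHopfForm.injective₃ (hH : IsHopfForm E H) :
    Function.Injective (tensorIncl₃ (E := E) H) := by
  let b := Module.Basis.ofVectorSpace K H
  refine injective_of_basis (E := E) (b.tensorProduct (b.tensorProduct b))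
    (tensorIncl₃ (E := E) H).toLinearMap ?_
  have := LinearIndependent.tmul_of_flat_right (hH.linInd _ b b.linearIndependent) (hH.linInd₂ b)
  simpa [Module.Basis.tensorProduct_apply'] using this

/-- The comultiplication of a `K`-form, obtained by restriction. -/
def formComul (hH : IsHopfForm E H) : H →ₐ[K] H ⊗[K] H :=
  (AlgEquiv.ofInjective (tensorIncl (E := E) H) hH.injective₂).symm.toAlgHom.comp
    ((((Bialgebra.comulAlgHom E A).restrictScalars K).comp H.val).codRestrict _
      (fun h => hH.comul_mem h h.2))

theorem tensorIncl_formComul (hH : IsHopfForm E H) (h : H) :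
    tensorIncl (E := E) H (formComul hH h) = Coalgebra.comul (R := E) (h : A) :=
  congrArg Subtype.val ((AlgEquiv.ofInjective (tensorIncl (E := E) H) hH.injective₂).apply_symm_apply
    ⟨Coalgebra.comul (R := E) (h : A), hH.comul_mem h h.2⟩)

/-- The counit of a `K`-form, obtained by restriction. -/
def formCounit (hH : IsHopfForm E H) : H →ₐ[K] K :=
  (AlgEquiv.ofInjective (Algebra.ofId K E) (algebraMap K E).injective).symm.toAlgHom.comp
    ((((Bialgebra.counitAlgHom E A).restrictScalars K).comp H.val).codRestrict _
      (fun h => hH.counit_mem h h.2))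

theorem algebraMap_formCounit (hH : IsHopfForm E H) (h : H) :
    algebraMap K E (formCounit hH h) = Coalgebra.counit (R := E) (h : A) :=
  congrArg Subtype.val
    ((AlgEquiv.ofInjective (Algebra.ofId K E) (algebraMap K E).injective).apply_symm_apply
    ⟨Coalgebra.counit (R := E) (h : A), hH.counit_mem h h.2⟩)

/-- The antipode of a `K`-form, obtained by restriction. -/
def formAntipode (hH : IsHopfForm E H) : H →ₗ[K] H :=
  (((HopfAlgebra.antipode E (A := A)).restrictScalars K).comp
    H.val.toLinearMap).codRestrict (Subalgebra.toSubmodule H) (fun h => hH.antipode_mem h h.2)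

theorem coe_formAntipode (hH : IsHopfForm E H) (h : H) :
    (formAntipode hH h : A) = HopfAlgebra.antipode E (h : A) := rfl

/-- The Hopf algebra structure on a `K`-form, obtained by restricting `Δ`, `ε` and `S`. -/
@[reducible] def IsHopfForm.hopfAlgebra (hH : IsHopfForm E H) : HopfAlgebra K H :=
  letI : Bialgebra K H := Bialgebra.ofAlgHom (formComul hH) (formCounit hH)
    (by
      ext h
      apply hH.injective₃
      have h1 : ∀ (t : H ⊗[K] H) (y : H), tensorIncl₃ (E := E) H
          (Algebra.TensorProduct.assoc K K K H H H (t ⊗ₜ y)) =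
          TensorProduct.assoc E A A A (tensorIncl H t ⊗ₜ (y : A)) := by
        intro t y
        induction t with
        | zero => simp
        | tmul a b => simp
        | add a b ha hb => simp only [TensorProduct.add_tmul, map_add, ha, hb]
      have h2 : ∀ t : H ⊗[K] H, tensorIncl₃ (E := E) H
          (Algebra.TensorProduct.assoc K K K H H H
            (Algebra.TensorProduct.map (formComul hH) (.id K H) t)) =
          TensorProduct.assoc E A A A
            ((Coalgebra.comul (R := E) (A := A)).rTensor A (tensorIncl H t)) := by
        intro t
        induction t with
        | zero => simp
        | tmul a b => simp [h1, tensorIncl_formComul]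
        | add a b ha hb => simp only [map_add, ha, hb]
      have h3 : ∀ t : H ⊗[K] H, tensorIncl₃ (E := E) H
            (Algebra.TensorProduct.map (.id K H) (formComul hH) t) =
            ((Coalgebra.comul (R := E) (A := A)).lTensor A (tensorIncl H t)) := by
        intro t
        induction t with
        | zero => simp
        | tmul a b => simp [tensorIncl_formComul]
        | add a b ha hb => simp only [map_add, ha, hb]
      refine (h2 _).trans (Eq.trans ?_ (h3 _).symm)
      simp [tensorIncl_formComul])
    (by
      ext h
      apply (Algebra.TensorProduct.lid K H).injective
      apply Subtype.val_injective
      have h2 : ∀ t : H ⊗[K] H, ((Algebra.TensorProduct.lid K H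
            (Algebra.TensorProduct.map (formCounit hH) (.id K H) t) : H) : A) =
          TensorProduct.lid E A
            ((Coalgebra.counit (R := E) (A := A)).rTensor A (tensorIncl H t)) := by
        intro t
        induction t with
        | zero => simp
        | tmul a b => simp [← algebraMap_formCounit hH]
        | add a b ha hb => simp only [map_add, Subalgebra.coe_add, ha, hb]
      refine (h2 _).trans ?_
      simp [tensorIncl_formComul])
    (by
      ext h
      apply (Algebra.TensorProduct.rid K K H).injective
      apply Subtype.val_injective
      have h2 : ∀ t : H ⊗[K] H, ((Algebra.TensorProduct.rid K K H
            (Algebra.TensorProduct.map (.id K H) (formCounit hH) t) : H) : A) =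
          TensorProduct.rid E A
            ((Coalgebra.counit (R := E) (A := A)).lTensor A (tensorIncl H t)) := by
        intro t
        induction t with
        | zero => simp
        | tmul a b => simp [← algebraMap_formCounit hH]
        | add a b ha hb => simp only [map_add, Subalgebra.coe_add, ha, hb]
      refine (h2 _).trans ?_
      simp [tensorIncl_formComul])
  { antipode := formAntipode hH
    mul_antipode_rTensor_comul := by
      ext h
      have h2 : ∀ t : H ⊗[K] H, ((LinearMap.mul' K H ((formAntipode hH).rTensor H t) : H) : A) =
          LinearMap.mul' E A ((HopfAlgebra.antipode E (A := A)).rTensor A (tensorIncl H t)) := by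
        intro t
        induction t with
        | zero => simp
        | tmul a b => simp [coe_formAntipode]
        | add a b ha hb => simp only [map_add, Subalgebra.coe_add, ha, hb]
      refine (h2 (formComul hH h)).trans ?_
      rw [tensorIncl_formComul, HopfAlgebra.mul_antipode_rTensor_comul_apply,
        ← algebraMap_formCounit hH, ← IsScalarTower.algebraMap_apply]
      rfl
    mul_antipode_lTensor_comul := by
      ext h
      have h2 : ∀ t : H ⊗[K] H, ((LinearMap.mul' K H ((formAntipode hH).lTensor H t) : H) : A) =
          LinearMap.mul' E A ((HopfAlgebra.antipode E (A := A)).lTensor A (tensorIncl H t)) := by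
        intro t
        induction t with
        | zero => simp
        | tmul a b => simp [coe_formAntipode]
        | add a b ha hb => simp only [map_add, Subalgebra.coe_add, ha, hb]
      refine (h2 (formComul hH h)).trans ?_
      rw [tensorIncl_formComul, HopfAlgebra.mul_antipode_lTensor_comul_apply,
        ← algebraMap_formCounit hH, ← IsScalarTower.algebraMap_apply]
      rfl }

end Descent
section FixedPoints

variable {K E M : Type*} [Field K] [Field E] [Algebra K E] [Group M]

/-- The simultaneous action of `Gal(E/K)` on the group algebra `E[M]` of a group `M` on which
`Gal(E/K)` acts by automorphisms: `σ • ∑ aₘ m = ∑ σ(aₘ) (θ σ m)`. -/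
def galAction (θ : Gal(E/K) →* MulAut M) :
    Gal(E/K) →* (MonoidAlgebra E M ≃ₐ[K] MonoidAlgebra E M) where
  toFun σ := (MonoidAlgebra.mapAlgEquiv K M σ).trans (MonoidAlgebra.domCongr K E (θ σ))
  map_one' := by
    refine AlgEquiv.ext fun x => ?_
    induction x using MonoidAlgebra.induction_linear with
    | zero => simp
    | add x y hx hy => simp only [map_add, hx, hy]
    | single m r => simp
  map_mul' σ τ := by
    refine AlgEquiv.ext fun x => ?_
    induction x using MonoidAlgebra.induction_linear with
    | zero => simp
    | add x y hx hy => simp only [map_add, hx, hy]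
    | single m r => simp

theorem galAction_single (θ : Gal(E/K) →* MulAut M) (σ : Gal(E/K)) (m : M) (a : E) :
    galAction θ σ (MonoidAlgebra.single m a) = MonoidAlgebra.single (θ σ m) (σ a) := by
  simp [galAction]

/-- The fixed points `E[M]^G` of `G = Gal(E/K)` acting simultaneously on `E` and on `M`. -/
def fixedAlgebra (θ : Gal(E/K) →* MulAut M) : Subalgebra K (MonoidAlgebra E M) where
  carrier := {x | ∀ σ, galAction θ σ x = x}
  mul_mem' hx hy σ := by rw [map_mul, hx σ, hy σ]
  add_mem' hx hy σ := by rw [map_add, hx σ, hy σ]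
  algebraMap_mem' r σ := AlgEquiv.commutes _ r

theorem galAction_smul (θ : Gal(E/K) →* MulAut M) (σ : Gal(E/K)) (a : E) (x : MonoidAlgebra E M) :
    galAction θ σ (a • x) = σ a • galAction θ σ x := by
  induction x using MonoidAlgebra.induction_linear with
  | zero => simp
  | add x y hx hy => simp only [smul_add, map_add, hx, hy]
  | single m r => simp [galAction_single]

theorem counit_galAction (θ : Gal(E/K) →* MulAut M) (σ : Gal(E/K)) (x : MonoidAlgebra E M) :
    Coalgebra.counit (R := E) (galAction θ σ x) = σ (Coalgebra.counit (R := E) x) := by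
  induction x using MonoidAlgebra.induction_linear with
  | zero => simp
  | add x y hx hy => simp only [map_add, hx, hy]
  | single m r => simp [galAction_single]

theorem antipode_galAction (θ : Gal(E/K) →* MulAut M) (σ : Gal(E/K)) (x : MonoidAlgebra E M) :
    HopfAlgebra.antipode E (galAction θ σ x) = galAction θ σ (HopfAlgebra.antipode E x) := by
  induction x using MonoidAlgebra.induction_linear with
  | zero => simp
  | add x y hx hy => simp only [map_add, hx, hy]
  | single m r => simp [galAction_single]

variable [FiniteDimensional K E]

/-- The trace `∑ σ, σ • x` as an element of `E[M]^G`. -/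
def orbitSum (θ : Gal(E/K) →* MulAut M) (x : MonoidAlgebra E M) : fixedAlgebra θ :=
  ⟨∑ σ, galAction θ σ x, fun τ => by
    rw [map_sum]
    exact Fintype.sum_equiv (Equiv.mulLeft τ) _ _ (fun σ => by simp)⟩

theorem coe_orbitSum (θ : Gal(E/K) →* MulAut M) (x : MonoidAlgebra E M) :
    (orbitSum θ x : MonoidAlgebra E M) = ∑ σ, galAction θ σ x := rfl

variable [IsGalois K E]

open Classical in
theorem exists_dual_families : ∃ b d : Gal(E/K) → E, ∀ σ τ : Gal(E/K),
    ∑ i, σ (b i) * τ (d i) = if σ = τ then 1 else 0 := by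
  have hc : Fintype.card (Fin (Module.finrank K E)) = Fintype.card Gal(E/K) := by
    rw [Fintype.card_fin, ← Nat.card_eq_fintype_card, IsGalois.card_aut_eq_finrank]
  let b : Module.Basis Gal(E/K) K E := (Module.finBasis K E).reindex (Fintype.equivOfCardEq hc)
  let B : Matrix Gal(E/K) Gal(E/K) E := fun σ i => σ (b i)
  let D : Matrix Gal(E/K) Gal(E/K) E := fun i τ => τ (b.traceDual i)
  have hDB : D * B = 1 := by
    ext i j
    have h2 := trace_eq_sum_automorphisms (K := K) (b.traceDual i * b j)
    rw [b.trace_traceDual_mul i j] at h2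
    simp only [map_mul] at h2
    rw [Matrix.mul_apply, Matrix.one_apply]
    refine h2.symm.trans ?_
    by_cases hij : i = j
    · simp [hij]
    · simp [hij, Ne.symm hij]
  have hBD : B * D = 1 := mul_eq_one_comm.1 hDB
  refine ⟨b, b.traceDual, fun σ τ => ?_⟩
  have := congrFun (congrFun hBD σ) τ
  rwa [Matrix.mul_apply, Matrix.one_apply] at this

theorem isHopfForm_fixedAlgebra (θ : Gal(E/K) →* MulAut M) :
    IsHopfForm E (fixedAlgebra θ) where
  linInd ι v hv := by
    rw [linearIndependent_iff'] at hv ⊢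
    intro s x hx i hi
    have key : ∀ e : E, Algebra.trace K E (x i * e) = 0 := by
      intro e
      refine hv s (fun i => Algebra.trace K E (x i * e)) ?_ i hi
      apply Subtype.val_injective
      rw [AddSubmonoidClass.coe_finsetSum]
      calc ∑ i ∈ s, ((Algebra.trace K E (x i * e) • v i : fixedAlgebra θ) : MonoidAlgebra E M)
          = ∑ σ : Gal(E/K), galAction θ σ (e • ∑ i ∈ s, x i • (v i : MonoidAlgebra E M)) := by
            simp only [Finset.smul_sum, map_sum, smul_smul, galAction_smul]
            rw [Finset.sum_comm]
            refine Finset.sum_congr rfl fun i _ => ?_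
            rw [Subalgebra.coe_smul, ← algebraMap_smul E, trace_eq_sum_automorphisms,
              Finset.sum_smul]
            refine Finset.sum_congr rfl fun σ _ => ?_
            rw [(v i).2 σ, mul_comm]
        _ = _ := by simp [hx]
    exact (traceForm_nondegenerate K E).1 (x i) key
  comul_mem h hh := by
    classical
    obtain ⟨b, d, hbd⟩ := exists_dual_families (K := K) (E := E)
    have h1 : ∀ (e : E) (m : M), Coalgebra.comul (R := E)
        (orbitSum θ (MonoidAlgebra.single m e) : MonoidAlgebra E M) ∈
        (tensorIncl (E := E) (fixedAlgebra θ)).range := by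
      intro e m
      refine ⟨∑ i, orbitSum θ (MonoidAlgebra.single m (e * b i)) ⊗ₜ
        orbitSum θ (MonoidAlgebra.single m (d i)), ?_⟩
      simp only [map_sum]
      have h3 : ∀ i, tensorIncl (E := E) (fixedAlgebra θ)
          (orbitSum θ (MonoidAlgebra.single m (e * b i)) ⊗ₜ
            orbitSum θ (MonoidAlgebra.single m (d i))) =
          ∑ σ, ∑ τ, (σ e * (σ (b i) * τ (d i))) •
            ((MonoidAlgebra.single (θ σ m) (1 : E)) ⊗ₜ[E]
              (MonoidAlgebra.single (θ τ m) (1 : E))) := by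
        intro i
        change (orbitSum θ (MonoidAlgebra.single m (e * b i)) : MonoidAlgebra E M) ⊗ₜ[E]
          (orbitSum θ (MonoidAlgebra.single m (d i)) : MonoidAlgebra E M) = _
        rw [coe_orbitSum, coe_orbitSum, TensorProduct.sum_tmul]
        refine Finset.sum_congr rfl fun σ _ => ?_
        rw [TensorProduct.tmul_sum]
        refine Finset.sum_congr rfl fun τ _ => ?_
        rw [galAction_single, galAction_single, ← mul_assoc, ← TensorProduct.smul_tmul_smul]
        simp
      change ∑ i, tensorIncl (E := E) (fixedAlgebra θ) _ = _
      simp only [h3]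
      rw [Finset.sum_comm]
      rw [coe_orbitSum, map_sum]
      refine Finset.sum_congr rfl fun σ _ => ?_
      rw [Finset.sum_comm]
      simp only [← Finset.sum_smul, ← Finset.mul_sum, hbd]
      have h5 : ∀ (n : M) (a : E), MonoidAlgebra.single n a = a • MonoidAlgebra.single n (1 : E) :=
        fun n a => by simp
      simp only [mul_ite, mul_one, mul_zero, ite_smul, zero_smul, Finset.sum_ite_eq,
        Finset.mem_univ, if_true, galAction_single, MonoidAlgebra.comul_single,
        CommSemiring.comul_apply, TensorProduct.map_tmul, MonoidAlgebra.lsingle_apply]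
      rw [h5 _ (σ e)]
      exact (TensorProduct.tmul_smul _ _ _).symm
    obtain ⟨c, hc⟩ := Algebra.trace_surjective K E 1
    have h2 : h = ∑ m ∈ h.coeff.support,
        (orbitSum θ (MonoidAlgebra.single m (c * h.coeff m)) : MonoidAlgebra E M) := by
      have h3 : ∑ σ, galAction θ σ (c • h) = h := by
        simp only [galAction_smul, hh _]
        rw [← Finset.sum_smul, ← trace_eq_sum_automorphisms, hc]
        simp
      have h4 : c • h = ∑ m ∈ h.coeff.support, MonoidAlgebra.single m (c * h.coeff m) := by
        conv_lhs => rw [← MonoidAlgebra.sum_coeff_single h]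
        simp [Finsupp.sum, Finset.smul_sum]
      conv_lhs => rw [← h3, h4]
      simp only [map_sum, coe_orbitSum]
      rw [Finset.sum_comm]
    rw [h2, map_sum]
    exact Subalgebra.sum_mem _ fun m _ => h1 _ _
  counit_mem h hh := by
    have : ∀ σ : Gal(E/K), σ (Coalgebra.counit (R := E) h) = Coalgebra.counit (R := E) h :=
      fun σ => by rw [← counit_galAction θ, hh σ]
    exact (IsGalois.mem_range_algebraMap_iff_fixed _).2 this
  antipode_mem h hh σ := by rw [← antipode_galAction, hh σ]

/-- The `K`-Hopf algebra structure on `E[M]^G`, restricted from the `E`-Hopf algebra `E[M]`. -/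
instance instHopfAlgebraFixedAlgebra (θ : Gal(E/K) →* MulAut M) : HopfAlgebra K (fixedAlgebra θ) :=
  (isHopfForm_fixedAlgebra θ).hopfAlgebra

/-- The comultiplication of `E[M]^G` is the restriction of that of `E[M]`. -/
theorem tensorIncl_comul (θ : Gal(E/K) →* MulAut M) (h : fixedAlgebra θ) :
    tensorIncl (E := E) (fixedAlgebra θ) (Coalgebra.comul (R := K) h) =
      Coalgebra.comul (R := E) (h : MonoidAlgebra E M) :=
  tensorIncl_formComul (isHopfForm_fixedAlgebra θ) h

/-- The counit of `E[M]^G` is the restriction of that of `E[M]`. -/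
theorem algebraMap_counit (θ : Gal(E/K) →* MulAut M) (h : fixedAlgebra θ) :
    algebraMap K E (Coalgebra.counit (R := K) h) =
      Coalgebra.counit (R := E) (h : MonoidAlgebra E M) :=
  algebraMap_formCounit (isHopfForm_fixedAlgebra θ) h

end FixedPoints

section Holomorph

variable (N : Type*) [Group N]

/-- The left regular embedding `λ : N → Perm N`, `λ(n)(x) = n x`. -/
def leftRegular : N →* Equiv.Perm N := MulAction.toPermHom N N

/-- The right regular embedding `ρ : N → Perm N`, `ρ(n)(x) = x n⁻¹`. -/
def rightRegular : N →* Equiv.Perm N where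
  toFun n := Equiv.mulRight n⁻¹
  map_one' := by ext; simp
  map_mul' a b := by ext; simp [mul_assoc]

/-- The holomorph of `N`: the normalizer of `λ(N)` in `Perm N`. -/
def Hol : Subgroup (Equiv.Perm N) :=
  Subgroup.normalizer ((leftRegular N).range : Set (Equiv.Perm N))

variable {N}

@[simp] theorem leftRegular_apply (n x : N) : leftRegular N n x = n * x := rfl

@[simp] theorem rightRegular_apply (n x : N) : rightRegular N n x = x * n⁻¹ := rfl

theorem mem_Hol_of (f : Equiv.Perm N) (φ : MulAut N)
    (h : ∀ n x, f (n * x) = φ n * f x) : f ∈ Hol N := by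
  refine Subgroup.mem_normalizer_iff.2 fun g => ⟨?_, ?_⟩
  · rintro ⟨n, rfl⟩
    refine ⟨φ n, Equiv.ext fun x => ?_⟩
    simp [h]
  · rintro ⟨n, hn⟩
    refine ⟨φ.symm n, Equiv.ext fun x => f.injective ?_⟩
    have := congrArg (fun p => p (f x)) hn
    simp only [leftRegular_apply, Equiv.Perm.mul_apply, Equiv.Perm.inv_def,
      Equiv.symm_apply_apply] at this
    rw [leftRegular_apply, h, ← this]
    simp

theorem apply_mul_of_mem_Hol {f : Equiv.Perm N} (hf : f ∈ Hol N) (n x : N) :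
    f (n * x) = f n * (f 1)⁻¹ * f x := by
  obtain ⟨m, hm⟩ := (Subgroup.mem_normalizer_iff.1 hf (leftRegular N n)).1 ⟨n, rfl⟩
  have key : ∀ y, m * f y = f (n * y) := fun y => by
    have := congrArg (fun p => p (f y)) hm
    simpa using this
  have h1 := key 1
  rw [mul_one] at h1
  rw [← key x, ← h1]
  group

/-- The automorphism `x ↦ f(x) f(1)⁻¹` attached to an element `f` of the holomorph. -/
def holAut (f : Hol N) : MulAut N where
  toEquiv := f.1.trans (Equiv.mulRight (f.1 1)⁻¹)
  map_mul' x y := by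
    simp [apply_mul_of_mem_Hol f.2 x y, mul_assoc]

@[simp] theorem holAut_apply (f : Hol N) (x : N) : holAut f x = f.1 x * (f.1 1)⁻¹ := rfl

theorem toPerm_apply (φ : MulAut N) (x : N) : MulAut.toPerm N φ x = φ x := rfl

variable (N)

/-- The decomposition `Hol N = ρ(N) ⋊ Aut N`, in which `(n, φ)` is the permutation `ρ(n) ∘ φ`. -/
def holEquiv : N ⋊[MonoidHom.id (MulAut N)] MulAut N ≃* Hol N where
  toFun p := ⟨rightRegular N p.left * MulAut.toPerm N p.right,
    mem_Hol_of _ p.right fun n x => by simp [toPerm_apply, mul_assoc]⟩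
  invFun f := ⟨(f.1 1)⁻¹, holAut f⟩
  left_inv p := by
    ext <;> simp [toPerm_apply]
  right_inv f := by
    apply Subtype.ext
    apply Equiv.ext
    intro x
    change f.1 x * (f.1 1)⁻¹ * ((f.1 1)⁻¹)⁻¹ = f.1 x
    simp
  map_mul' p q := by
    apply Subtype.ext
    apply Equiv.ext
    intro x
    simp [toPerm_apply, mul_assoc]

/-- The projection of `Hol N = ρ(N) ⋊ Aut N` onto the component `Aut N`. -/
def holProj : Hol N →* MulAut N :=
  SemidirectProduct.rightHom.comp (holEquiv N).symm.toMonoidHom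

end Holomorph

section GreitherPareigis

variable {K E : Type*} [Field K] [Field E] [Algebra K E]

/-- The left coset space `X = G/G_L`, where `G = Gal(E/K)` and `G_L = Gal(E/L)`. -/
abbrev CosetSpace (L : IntermediateField K E) : Type _ := Gal(E/K) ⧸ L.fixingSubgroup

/-- The homomorphism `λ : G → Perm X`, `λ(σ)(τ G_L) = σ τ G_L`. -/
def lam (L : IntermediateField K E) : Gal(E/K) →* Equiv.Perm (CosetSpace L) :=
  MulAction.toPermHom Gal(E/K) (CosetSpace L)

/-- A subgroup of `Perm X` is regular if it has the same size as `X` and is transitive on `X`. -/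
def IsRegularSubgroup {X : Type*} (M : Subgroup (Equiv.Perm X)) : Prop :=
  Nat.card M = Nat.card X ∧ ∀ x y : X, ∃ p ∈ M, p x = y

/-- The embeddings `α : N → Perm X` whose image is regular and normalized by `λ(G)`. -/
structure RegularEmbedding (L : IntermediateField K E) (N : Type*) [Group N] where
  toHom : N →* Equiv.Perm (CosetSpace L)
  injective : Function.Injective toHom
  regular : IsRegularSubgroup toHom.range
  normalized : (lam L).range ≤
    Subgroup.normalizer (toHom.range : Set (Equiv.Perm (CosetSpace L)))

/-- The embeddings `β : G → Hol N` such that `β(G_L)` is the stabilizer of `e_N` in `β(G)`. -/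
structure HolEmbedding (L : IntermediateField K E) (N : Type*) [Group N] where
  toHom : Gal(E/K) →* Hol N
  injective : Function.Injective toHom
  stabilizer : ∀ b : Hol N,
    b ∈ L.fixingSubgroup.map toHom ↔ b ∈ toHom.range ∧ (b : Equiv.Perm N) 1 = 1

variable {L : IntermediateField K E} {N : Type*} [Group N]

namespace RegularEmbedding

/-- The action `σ ∗ η = λ(σ) η λ(σ)⁻¹` of `G` on `α(N)`. -/
def conjAction (α : RegularEmbedding L N) : Gal(E/K) →* MulAut α.toHom.range :=
  α.toHom.range.normalizerMonoidHom.comp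
    ((lam L).codRestrict _ fun σ => α.normalized ⟨σ, rfl⟩)

theorem coe_conjAction (α : RegularEmbedding L N) (σ : Gal(E/K)) (η : α.toHom.range) :
    (α.conjAction σ η : Equiv.Perm (CosetSpace L)) = lam L σ * η * (lam L σ)⁻¹ := rfl

/-- The Hopf algebra `E[α(N)]^G`. -/
abbrev hopfAlgebra (α : RegularEmbedding L N) :
    Subalgebra K (MonoidAlgebra E α.toHom.range) :=
  fixedAlgebra α.conjAction

theorem lam_injective [IsNormalClosure K L E] : Function.Injective (lam L) := by
  have : Normal K E := IsNormalClosure.normal (K := L)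
  rw [injective_iff_map_eq_one]
  intro σ hσ
  have h1 : ∀ (τ : Gal(E/K)) (x : L), σ (τ x) = τ x := by
    intro τ x
    have h2 : ((σ * τ : Gal(E/K)) : CosetSpace L) = (τ : CosetSpace L) :=
      congrArg (fun p => p (τ : CosetSpace L)) hσ
    have h3 := (IntermediateField.mem_fixingSubgroup_iff L _).1
      (QuotientGroup.eq.1 h2.symm) x x.2
    have := congrArg τ h3
    simpa using this
  have h4 : (⊤ : IntermediateField K E) ≤
      IntermediateField.fixedField (Subgroup.zpowers σ) := by
    rw [← IsNormalClosure.adjoin_rootSet (F := K) (K := L) (L := E)]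
    refine iSup_le fun x => IntermediateField.adjoin_le_iff.2 fun y hy => ?_
    have hy' : Polynomial.aeval y (minpoly K (x : E)) = 0 := by
      have := (Polynomial.mem_rootSet.1 hy).2
      rwa [← minpoly.algebraMap_eq (algebraMap L E).injective] at this
    obtain ⟨τ, hτ⟩ := minpoly.exists_algEquiv_of_root (Algebra.IsAlgebraic.isAlgebraic (x : E)) hy'
    rintro ⟨g, k, rfl⟩
    have h5 : σ ∈ MulAction.stabilizer Gal(E/K) y := by
      have h6 : y = τ⁻¹ (x : E) := by
        rw [← hτ]
        exact (τ.symm_apply_apply y).symm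
      rw [h6]
      exact h1 τ⁻¹ x
    exact (MulAction.stabilizer Gal(E/K) y).zpow_mem h5 k
  ext y
  exact h4 (IntermediateField.mem_top : y ∈ ⊤) ⟨σ, Subgroup.mem_zpowers σ⟩

variable [FiniteDimensional K E]

theorem orbitMap_bijective (α : RegularEmbedding L N) :
    Function.Bijective fun η : N => α.toHom η ((1 : Gal(E/K)) : CosetSpace L) := by
  have hcard : Nat.card N = Nat.card (CosetSpace L) := by
    rw [← α.regular.1]
    exact Nat.card_congr (MonoidHom.ofInjective α.injective).toEquiv
  have : Finite N := (Nat.card_pos_iff.1 (hcard ▸ Nat.card_pos)).2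
  have : Finite (CosetSpace L) := inferInstance
  refine (Nat.bijective_iff_surjective_and_card _).2 ⟨fun x => ?_, hcard⟩
  obtain ⟨_, ⟨η, rfl⟩, hη⟩ := α.regular.2 ((1 : Gal(E/K)) : CosetSpace L) x
  exact ⟨η, hη⟩

/-- The bijection `a : N → X`, `a(η) = α(η)(e G_L)`, attached to a regular embedding `α`. -/
def orbitEquiv (α : RegularEmbedding L N) : N ≃ CosetSpace L :=
  Equiv.ofBijective _ α.orbitMap_bijective

theorem orbitEquiv_apply (α : RegularEmbedding L N) (η : N) :
    α.orbitEquiv η = α.toHom η ((1 : Gal(E/K)) : CosetSpace L) := rfl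

theorem orbitEquiv_mul (α : RegularEmbedding L N) (η x : N) :
    α.orbitEquiv (η * x) = α.toHom η (α.orbitEquiv x) := by
  simp [orbitEquiv_apply]

theorem translate_mem_Hol (α : RegularEmbedding L N) (σ : Gal(E/K)) :
    α.orbitEquiv.symm.permCongr (lam L σ) ∈ Hol N := by
  let i : N ≃* α.toHom.range := MonoidHom.ofInjective α.injective
  let φ : MulAut N := (i.trans (α.conjAction σ)).trans i.symm
  have hφ : ∀ n, α.toHom (φ n) = lam L σ * α.toHom n * (lam L σ)⁻¹ := by
    intro n
    have : i (φ n) = α.conjAction σ (i n) := by simp [φ]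
    have := congrArg Subtype.val this
    exact this
  refine mem_Hol_of _ φ fun n x => α.orbitEquiv.injective ?_
  simp [Equiv.permCongr_apply, orbitEquiv_mul, hφ]

/-- Byott's translation as a homomorphism: `β(σ) = a⁻¹ ∘ λ(σ) ∘ a`. -/
def translateHom (α : RegularEmbedding L N) : Gal(E/K) →* Hol N :=
  (α.orbitEquiv.symm.permCongrHom.toMonoidHom.comp (lam L)).codRestrict (Hol N)
    α.translate_mem_Hol

theorem orbitEquiv_translateHom (α : RegularEmbedding L N) (σ : Gal(E/K)) (η : N) :
    α.orbitEquiv ((α.translateHom σ : Equiv.Perm N) η) = lam L σ (α.orbitEquiv η) :=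
  α.orbitEquiv.apply_symm_apply _

theorem translateHom_apply_one (α : RegularEmbedding L N) (σ : Gal(E/K)) :
    (α.translateHom σ : Equiv.Perm N) 1 = 1 ↔ σ ∈ L.fixingSubgroup := by
  rw [← α.orbitEquiv.injective.eq_iff, orbitEquiv_translateHom, orbitEquiv_apply, map_one]
  change ((σ * 1 : Gal(E/K)) : CosetSpace L) = ((1 : Gal(E/K)) : CosetSpace L) ↔ _
  rw [mul_one, eq_comm, QuotientGroup.eq]
  simp

/-- Byott's translation: the embedding `β : G → Hol N` corresponding to `α : N → Perm X`. It is
`β(σ) = a⁻¹ ∘ λ(σ) ∘ a`, where `a : N → X` is the bijection `a(η) = α(η)(e G_L)`. -/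
def byott [IsNormalClosure K L E] (α : RegularEmbedding L N) : HolEmbedding L N where
  toHom := α.translateHom
  injective σ τ h := lam_injective (L := L) <|
    α.orbitEquiv.symm.permCongrHom.injective (congrArg Subtype.val h)
  stabilizer b := by
    constructor
    · rintro ⟨σ, hσ, rfl⟩
      exact ⟨⟨σ, rfl⟩, (α.translateHom_apply_one σ).2 hσ⟩
    · rintro ⟨⟨σ, rfl⟩, h⟩
      exact ⟨σ, (α.translateHom_apply_one σ).1 h, rfl⟩

end RegularEmbedding

/-- The composition `β̄ : G → Aut N` of `β : G → Hol N = ρ(N) ⋊ Aut N` with the projection onto the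
automorphism component. -/
def HolEmbedding.autPart (β : HolEmbedding L N) : Gal(E/K) →* MulAut N :=
  (holProj N).comp β.toHom

end GreitherPareigis

end HopfGalois

end

/-!
Galois descent: base change along `E/K` recovers `E[M]` from `E[M]^G`, and this identifies the
isomorphisms of `K`-bialgebras `E[M₁]^G ≃ E[M₂]^G` with the `G`-equivariant isomorphisms of
`E`-bialgebras `E[M₁] ≃ E[M₂]`. The latter permute the group-like elements, which are just the
elements of the groups, so they are the `G`-equivariant isomorphisms `M₁ ≃* M₂`. Finally, transport
along `α : N ≃* α(N)` turns conjugation by `λ(σ)` into `β̄(σ)`, and an equivariant isomorphism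
`α₁(N) ≃* α₂(N)` into an automorphism of `N` conjugating `β̄₁` to `β̄₂`.
-/

noncomputable section

open scoped TensorProduct

namespace HopfGalois

section TensorSquare

variable {K E : Type*} [CommSemiring K] [CommSemiring E] [Algebra K E]
  {H A : Type*} [Semiring H] [Algebra K H] [Semiring A] [Algebra K A] [Algebra E A]
  [IsScalarTower K E A]

variable (E) in
/-- The map `H ⊗[K] H → A ⊗[E] A` induced by `j : H → A`. For the inclusion of a subalgebra it is
`tensorIncl`. -/
def tensorSquare (j : H →ₐ[K] A) : H ⊗[K] H →ₐ[K] A ⊗[E] A :=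
  (Algebra.TensorProduct.mapOfCompatibleSMul E K K A A).comp (Algebra.TensorProduct.map j j)

theorem tensorSquare_tmul (j : H →ₐ[K] A) (x y : H) :
    tensorSquare E j (x ⊗ₜ y) = j x ⊗ₜ j y := rfl

theorem tensorSquare_map {H' A' : Type*} [Semiring H'] [Algebra K H'] [Semiring A'] [Algebra K A']
    [Algebra E A'] [IsScalarTower K E A'] {j : H →ₐ[K] A} {j' : H' →ₐ[K] A'} {f : H →ₗ[K] H'}
    {F : A →ₗ[E] A'} (h : ∀ x, F (j x) = j' (f x)) (t : H ⊗[K] H) :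
    tensorSquare E j' (TensorProduct.map f f t) = TensorProduct.map F F (tensorSquare E j t) := by
  induction t with
  | zero => simp only [map_zero]
  | tmul x y => simp only [TensorProduct.map_tmul, tensorSquare_tmul, h]
  | add x y hx hy => simp only [map_add, hx, hy]

end TensorSquare

section BaseChange

variable {K E : Type*} [CommSemiring K] [CommSemiring E] [Algebra K E]
  {H A B : Type*} [Semiring H] [Algebra K H] [Semiring A] [Algebra K A] [Algebra E A]
  [IsScalarTower K E A] [Semiring B] [Algebra E B] {j : H →ₐ[K] A}

theorem algHom_ext_of_isBaseChange (hj : IsBaseChange E j.toLinearMap) {F F' : A →ₐ[E] B}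
    (h : ∀ x, F (j x) = F' (j x)) : F = F' :=
  AlgHom.toLinearMap_injective (hj.algHom_ext _ _ h)

variable [Algebra K B] [IsScalarTower K E B]

theorem lift_mul_of_isBaseChange (hj : IsBaseChange E j.toLinearMap) (f : H →ₐ[K] B) (x y : A) :
    hj.lift f.toLinearMap (x * y) = hj.lift f.toLinearMap x * hj.lift f.toLinearMap y := by
  have lift_apply (h : H) : hj.lift f.toLinearMap (j h) = f h := hj.lift_eq _ h
  induction x using hj.inductionOn with
  | zero => simp only [zero_mul, map_zero]
  | add x x' hx hx' => simp only [add_mul, map_add, hx, hx']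
  | smul a x hx => simp only [smul_mul_assoc, map_smul, hx]
  | tmul h =>
    induction y using hj.inductionOn with
    | zero => simp only [mul_zero, map_zero]
    | add y y' hy hy' => simp only [mul_add, map_add, hy, hy']
    | smul a y hy => simp only [mul_smul_comm, map_smul, hy]
    | tmul h' =>
      simp only [AlgHom.toLinearMap_apply, lift_apply, ← map_mul]

/-- The extension of an algebra homomorphism along a base change. -/
def liftAlgHom (hj : IsBaseChange E j.toLinearMap) (f : H →ₐ[K] B) : A →ₐ[E] B :=
  .ofLinearMap (hj.lift f.toLinearMap)
    (by simpa only [AlgHom.toLinearMap_apply, map_one] using hj.lift_eq f.toLinearMap 1)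
    (lift_mul_of_isBaseChange hj f)

theorem liftAlgHom_apply (hj : IsBaseChange E j.toLinearMap) (f : H →ₐ[K] B) (h : H) :
    liftAlgHom hj f (j h) = f h :=
  hj.lift_eq f.toLinearMap h

end BaseChange

section BialgebraForm

variable {K E : Type*} [CommSemiring K] [CommSemiring E] [Algebra K E]
  {H A : Type*} [Semiring H] [Bialgebra K H] [Semiring A] [Bialgebra E A] [Algebra K A]
  [IsScalarTower K E A]
  {H₁ A₁ : Type*} [Semiring H₁] [Bialgebra K H₁] [Semiring A₁] [Bialgebra E A₁] [Algebra K A₁]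
  [IsScalarTower K E A₁]
  {H₂ A₂ : Type*} [Semiring H₂] [Bialgebra K H₂] [Semiring A₂] [Bialgebra E A₂] [Algebra K A₂]
  [IsScalarTower K E A₂]

variable (E) in
/-- The map `j : H → A` exhibits the `K`-bialgebra `H` as a `K`-form of the `E`-bialgebra `A`: it
induces an isomorphism `E ⊗[K] H ≃ A` and is compatible with the coalgebra structures over the
two base rings. -/
structure IsBialgebraForm (j : H →ₐ[K] A) : Prop where
  isBaseChange : IsBaseChange E j.toLinearMap
  counit_apply (h : H) :
    Coalgebra.counit (R := E) (j h) = algebraMap K E (Coalgebra.counit (R := K) h)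
  comul_apply (h : H) :
    Coalgebra.comul (R := E) (j h) = tensorSquare E j (Coalgebra.comul (R := K) h)

namespace IsBialgebraForm

variable {j₁ : H₁ →ₐ[K] A₁} {j₂ : H₂ →ₐ[K] A₂}

/-- The base change to `E` of a homomorphism of `K`-forms. -/
def extendBialgHom (h₁ : IsBialgebraForm E j₁) (h₂ : IsBialgebraForm E j₂) (f : H₁ →ₐc[K] H₂) :
    A₁ →ₐc[E] A₂ :=
  let F : A₁ →ₐ[E] A₂ := liftAlgHom h₁.isBaseChange (j₂.comp f)
  have F_apply (x : H₁) : F (j₁ x) = j₂ (f x) := liftAlgHom_apply h₁.isBaseChange _ x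
  .ofAlgHom F
    (algHom_ext_of_isBaseChange h₁.isBaseChange fun x => by
      change Coalgebra.counit (R := E) (F (j₁ x)) = Coalgebra.counit (R := E) (j₁ x)
      rw [F_apply, h₂.counit_apply, h₁.counit_apply, CoalgHomClass.counit_comp_apply])
    (algHom_ext_of_isBaseChange h₁.isBaseChange fun x => by
      change TensorProduct.map F.toLinearMap F.toLinearMap (Coalgebra.comul (R := E) (j₁ x)) =
        Coalgebra.comul (R := E) (F (j₁ x))
      rw [F_apply, h₁.comul_apply, h₂.comul_apply, ← CoalgHomClass.map_comp_comul_apply]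
      exact (tensorSquare_map F_apply _).symm)

theorem extendBialgHom_apply (h₁ : IsBialgebraForm E j₁) (h₂ : IsBialgebraForm E j₂)
    (f : H₁ →ₐc[K] H₂) (x : H₁) : h₁.extendBialgHom h₂ f (j₁ x) = j₂ (f x) :=
  liftAlgHom_apply h₁.isBaseChange _ x

theorem extendBialgHom_symm_comp (h₁ : IsBialgebraForm E j₁) (h₂ : IsBialgebraForm E j₂)
    (f : H₁ ≃ₐc[K] H₂) :
    (h₂.extendBialgHom h₁ (f.symm : H₂ →ₐc[K] H₁)).comp
      (h₁.extendBialgHom h₂ (f : H₁ →ₐc[K] H₂)) = .id E A₁ :=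
  BialgHom.coe_toAlgHom_injective <| algHom_ext_of_isBaseChange h₁.isBaseChange fun x => by
    change h₂.extendBialgHom h₁ _ (h₁.extendBialgHom h₂ _ (j₁ x)) = j₁ x
    rw [extendBialgHom_apply, extendBialgHom_apply]
    exact congrArg j₁ (f.symm_apply_apply x)

/-- The base change to `E` of an isomorphism of `K`-forms. -/
def extendEquiv (h₁ : IsBialgebraForm E j₁) (h₂ : IsBialgebraForm E j₂) (f : H₁ ≃ₐc[K] H₂) :
    A₁ ≃ₐc[E] A₂ :=
  .ofBialgHom (h₁.extendBialgHom h₂ f) (h₂.extendBialgHom h₁ f.symm)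
    (extendBialgHom_symm_comp h₂ h₁ f.symm) (extendBialgHom_symm_comp h₁ h₂ f)

theorem extendEquiv_apply (h₁ : IsBialgebraForm E j₁) (h₂ : IsBialgebraForm E j₂)
    (f : H₁ ≃ₐc[K] H₂) (x : H₁) : h₁.extendEquiv h₂ f (j₁ x) = j₂ (f x) :=
  extendBialgHom_apply h₁ h₂ _ x

/-- The isomorphism of `K`-forms to which an isomorphism of `E`-bialgebras restricts. -/
def restrictEquiv (h₁ : IsBialgebraForm E j₁) (h₂ : IsBialgebraForm E j₂)
    (hKE : Function.Injective (algebraMap K E)) (hj₂ : Function.Injective (tensorSquare E j₂))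
    (F : A₁ ≃ₐc[E] A₂) (f : H₁ ≃ₐ[K] H₂) (hf : ∀ x, F (j₁ x) = j₂ (f x)) : H₁ ≃ₐc[K] H₂ :=
  .ofAlgEquiv f
    (AlgHom.ext fun x => hKE <| by
      change algebraMap K E (Coalgebra.counit (R := K) (f x)) =
        algebraMap K E (Coalgebra.counit (R := K) x)
      rw [← h₁.counit_apply, ← h₂.counit_apply, ← hf, CoalgHomClass.counit_comp_apply])
    (AlgHom.ext fun x => hj₂ <| by
      change tensorSquare E j₂ (TensorProduct.map f.toLinearMap f.toLinearMap
          (Coalgebra.comul (R := K) x)) =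
        tensorSquare E j₂ (Coalgebra.comul (R := K) (f x))
      rw [tensorSquare_map (F := (F : A₁ →ₗ[E] A₂)) hf, ← h₁.comul_apply, ← h₂.comul_apply,
        ← hf]
      exact CoalgHomClass.map_comp_comul_apply F (j₁ x))

end IsBialgebraForm

end BialgebraForm

section HopfForm

universe u

variable {K E : Type*} {A : Type u} [Field K] [Field E] [Algebra K E] [Ring A] [HopfAlgebra E A]
  [Algebra K A] [IsScalarTower K E A] {H : Subalgebra K A}

theorem IsHopfForm.isBaseChange (hH : IsHopfForm E H)
    (hspan : Submodule.span E (H : Set A) = ⊤) : IsBaseChange E H.val.toLinearMap := by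
  let b := Module.Basis.ofVectorSpace K H
  let F : E ⊗[K] H →ₗ[E] A := H.val.toLinearMap.liftBaseChange E
  have F_one_tmul (h : H) : F (1 ⊗ₜ h) = h := LinearMap.liftBaseChange_one_tmul E _ h
  have injective_F : Function.Injective F := by
    refine injective_of_basis (E := E) (b.baseChange E) F ?_
    simpa only [Module.Basis.baseChange_apply, F_one_tmul] using
      hH.linInd _ b b.linearIndependent
  have surjective_F : Function.Surjective F := by
    rw [← LinearMap.range_eq_top, LinearMap.range_liftBaseChange, ← hspan]
    exact congrArg _ Subtype.range_coe
  exact .of_equiv (.ofBijective F ⟨injective_F, surjective_F⟩) F_one_tmul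

end HopfForm

section FixedAlgebra

variable {K E : Type*} [Field K] [Field E] [Algebra K E] {M M₁ M₂ : Type*} [Group M] [Group M₁]
  [Group M₂] {θ₁ : Gal(E/K) →* MulAut M₁} {θ₂ : Gal(E/K) →* MulAut M₂}

theorem map_fixedAlgebra (F : MonoidAlgebra E M₁ ≃ₐ[K] MonoidAlgebra E M₂)
    (hF : ∀ σ x, F (galAction θ₁ σ x) = galAction θ₂ σ (F x)) :
    (fixedAlgebra θ₁).map (F : MonoidAlgebra E M₁ →ₐ[K] MonoidAlgebra E M₂) =
      fixedAlgebra θ₂ := by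
  ext y
  obtain ⟨x, rfl⟩ := F.surjective y
  have mem_iff : F x ∈ fixedAlgebra θ₂ ↔ x ∈ fixedAlgebra θ₁ :=
    forall_congr' fun σ => by rw [← hF, F.injective.eq_iff]
  exact F.injective.mem_set_image.trans mem_iff.symm

theorem equivariant_iff_of_map_single {Φ : Type*}
    [FunLike Φ (MonoidAlgebra E M₁) (MonoidAlgebra E M₂)]
    [AddMonoidHomClass Φ (MonoidAlgebra E M₁) (MonoidAlgebra E M₂)] {F : Φ} {e : M₁ → M₂}
    (hF : ∀ m r, F (.single m r) = .single (e m) r) :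
    (∀ σ x, F (galAction θ₁ σ x) = galAction θ₂ σ (F x)) ↔
      ∀ σ m, e (θ₁ σ m) = θ₂ σ (e m) := by
  refine forall_congr' fun σ => ⟨fun h m => ?_, fun h x => ?_⟩
  · refine MonoidAlgebra.single_left_injective (R := E) one_ne_zero ?_
    simpa only [galAction_single, hF, map_one] using h (.single m 1)
  · induction x using MonoidAlgebra.induction_linear with
    | zero => simp only [map_zero]
    | add x y hx hy => simp only [map_add, hx, hy]
    | single m r => simp only [galAction_single, hF, h]

variable [FiniteDimensional K E] [IsGalois K E]

theorem span_fixedAlgebra (θ : Gal(E/K) →* MulAut M) :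
    Submodule.span E (fixedAlgebra θ : Set (MonoidAlgebra E M)) = ⊤ := by
  classical
  refine eq_top_iff.2 fun x _ => ?_
  obtain ⟨b, d, hbd⟩ := exists_dual_families (K := K) (E := E)
  have sum_smul_orbitSum : ∑ i, d i • (orbitSum θ (b i • x) : MonoidAlgebra E M) = x := calc
    _ = ∑ σ, (∑ i, σ (b i) * d i) • galAction θ σ x := by
      simp only [coe_orbitSum, galAction_smul, Finset.smul_sum, Finset.sum_smul, smul_smul,
        mul_comm (d _)]
      exact Finset.sum_comm
    _ = ∑ σ, (if σ = 1 then (1 : E) else 0) • galAction θ σ x :=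
      Finset.sum_congr rfl fun σ _ => congrArg (· • _) (hbd σ 1)
    _ = x := by simp
  rw [← sum_smul_orbitSum]
  exact Submodule.sum_mem _ fun i _ =>
    Submodule.smul_mem _ _ (Submodule.subset_span (orbitSum θ (b i • x)).2)

theorem isBialgebraForm_fixedAlgebra (θ : Gal(E/K) →* MulAut M) :
    IsBialgebraForm E (fixedAlgebra θ).val where
  isBaseChange := (isHopfForm_fixedAlgebra θ).isBaseChange (span_fixedAlgebra θ)
  counit_apply h := (algebraMap_counit θ h).symm
  comul_apply h := (tensorIncl_comul θ h).symm

theorem equivariant_iff_map_fixedAlgebra_le {Φ : Type*}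
    [FunLike Φ (MonoidAlgebra E M₁) (MonoidAlgebra E M₂)]
    [LinearMapClass Φ E (MonoidAlgebra E M₁) (MonoidAlgebra E M₂)] {F : Φ} :
    (∀ σ x, F (galAction θ₁ σ x) = galAction θ₂ σ (F x)) ↔
      ∀ x ∈ fixedAlgebra θ₁, F x ∈ fixedAlgebra θ₂ := by
  refine ⟨fun hF x hx σ => by rw [← hF, hx σ], fun hF σ x => ?_⟩
  induction x using (isBialgebraForm_fixedAlgebra θ₁).isBaseChange.inductionOn with
  | zero => simp only [map_zero]
  | tmul h => exact (congrArg F (h.2 σ)).trans (hF h h.2 σ).symm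
  | smul a x hx => simp only [galAction_smul, map_smul, hx]
  | add x y hx hy => simp only [map_add, hx, hy]

theorem nonempty_fixedAlgebra_equiv_iff_exists_bialgEquiv :
    Nonempty (fixedAlgebra θ₁ ≃ₐc[K] fixedAlgebra θ₂) ↔
      ∃ F : MonoidAlgebra E M₁ ≃ₐc[E] MonoidAlgebra E M₂,
        ∀ σ x, F (galAction θ₁ σ x) = galAction θ₂ σ (F x) := by
  have h₁ := isBialgebraForm_fixedAlgebra θ₁
  have h₂ := isBialgebraForm_fixedAlgebra θ₂
  constructor
  · rintro ⟨f⟩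
    exact ⟨h₁.extendEquiv h₂ f, equivariant_iff_map_fixedAlgebra_le.2 fun x hx =>
      h₁.extendEquiv_apply h₂ f ⟨x, hx⟩ ▸ (f ⟨x, hx⟩).2⟩
  · rintro ⟨F, hF⟩
    let FK : MonoidAlgebra E M₁ ≃ₐ[K] MonoidAlgebra E M₂ := F.toAlgEquiv.restrictScalars K
    let f : fixedAlgebra θ₁ ≃ₐ[K] fixedAlgebra θ₂ :=
      (FK.subalgebraMap _).trans (Subalgebra.equivOfEq _ _ (map_fixedAlgebra FK hF))
    exact ⟨h₁.restrictEquiv h₂ (algebraMap K E).injective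
      (isHopfForm_fixedAlgebra θ₂).injective₂ F f fun _ => rfl⟩

end FixedAlgebra

section GroupLike

variable {R : Type*} [CommRing R] [IsDomain R] {M₁ M₂ : Type*} [Group M₁] [Group M₂]

/-- The isomorphism of groups induced by an isomorphism of their group algebras as bialgebras, by
restriction to the group-like elements. -/
def groupLikeEquiv (F : MonoidAlgebra R M₁ ≃ₐc[R] MonoidAlgebra R M₂) : M₁ ≃* M₂ :=
  MonoidHom.toMulEquiv (MonoidAlgebra.mapDomainOfBialgHom (R := R) F)
    (MonoidAlgebra.mapDomainOfBialgHom (R := R) F.symm)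
    (by rw [← MonoidAlgebra.mapDomainOfBialgHom_comp, BialgEquiv.symm_comp,
      MonoidAlgebra.mapDomainOfBialgHom_id])
    (by rw [← MonoidAlgebra.mapDomainOfBialgHom_comp, BialgEquiv.comp_symm,
      MonoidAlgebra.mapDomainOfBialgHom_id])

theorem single_groupLikeEquiv (F : MonoidAlgebra R M₁ ≃ₐc[R] MonoidAlgebra R M₂) (m : M₁) (r : R) :
    MonoidAlgebra.single (groupLikeEquiv F m) r = F (.single m r) :=
  MonoidAlgebra.single_mapDomainOfBialgHom (F : MonoidAlgebra R M₁ →ₐc[R] MonoidAlgebra R M₂) m r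

end GroupLike

section GaloisDescent

variable {K E : Type*} [Field K] [Field E] [Algebra K E] [FiniteDimensional K E] [IsGalois K E]
  {M₁ M₂ : Type*} [Group M₁] [Group M₂]
  {θ₁ : Gal(E/K) →* MulAut M₁} {θ₂ : Gal(E/K) →* MulAut M₂}

theorem nonempty_fixedAlgebra_equiv_iff_exists_mulEquiv :
    Nonempty (fixedAlgebra θ₁ ≃ₐc[K] fixedAlgebra θ₂) ↔
      ∃ e : M₁ ≃* M₂, ∀ σ m, e (θ₁ σ m) = θ₂ σ (e m) := by
  rw [nonempty_fixedAlgebra_equiv_iff_exists_bialgEquiv]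
  constructor
  · rintro ⟨F, hF⟩
    exact ⟨groupLikeEquiv F,
      (equivariant_iff_of_map_single fun m r => (single_groupLikeEquiv F m r).symm).1 hF⟩
  · rintro ⟨e, he⟩
    exact ⟨MonoidAlgebra.domCongrBialgEquiv E E e,
      (equivariant_iff_of_map_single (MonoidAlgebra.domCongr_single (R := E) e)).2 he⟩

end GaloisDescent

section Conjugation

variable {Γ : Type*}

theorem exists_equivariant_mulEquiv_iff {N M₁ M₂ : Type*} [Mul N] [Mul M₁] [Mul M₂]
    {ψ₁ ψ₂ : Γ → MulAut N} {θ₁ : Γ → MulAut M₁} {θ₂ : Γ → MulAut M₂} (e₁ : N ≃* M₁) (e₂ : N ≃* M₂)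
    (h₁ : ∀ σ n, e₁ (ψ₁ σ n) = θ₁ σ (e₁ n)) (h₂ : ∀ σ n, e₂ (ψ₂ σ n) = θ₂ σ (e₂ n)) :
    (∃ e : M₁ ≃* M₂, ∀ σ m, e (θ₁ σ m) = θ₂ σ (e m)) ↔
      ∃ μ : MulAut N, ∀ σ, ψ₂ σ = μ * ψ₁ σ * μ⁻¹ := by
  simp only [eq_mul_inv_iff_mul_eq]
  constructor
  · rintro ⟨e, he⟩
    refine ⟨(e₁.trans e).trans e₂.symm, fun σ => MulEquiv.ext fun n => e₂.injective ?_⟩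
    simp only [MulAut.mul_apply, MulEquiv.trans_apply, h₁, h₂, MulEquiv.apply_symm_apply, he]
  · rintro ⟨μ, hμ⟩
    refine ⟨(e₁.symm.trans μ).trans e₂, fun σ m => ?_⟩
    obtain ⟨n, rfl⟩ := e₁.surjective m
    have hμn : ψ₂ σ (μ n) = μ (ψ₁ σ n) := DFunLike.congr_fun (hμ σ) n
    simp only [MulEquiv.trans_apply, ← h₁, ← h₂, MulEquiv.symm_apply_apply, hμn]

theorem exists_conj_iff_of_mul_comm {M : Type*} [Group M] (hM : ∀ a b : M, a * b = b * a)
    {f₁ f₂ : Γ → M} : (∃ μ, ∀ σ, f₂ σ = μ * f₁ σ * μ⁻¹) ↔ ∀ σ, f₁ σ = f₂ σ := by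
  simp only [hM _ (f₁ _), mul_inv_cancel_right, exists_const, eq_comm]

theorem mulAut_mul_comm_of_isCyclic {N : Type*} [Group N] [IsCyclic N] (φ ψ : MulAut N) :
    φ * ψ = ψ * φ :=
  (IsCyclic.mulAutMulEquiv N).injective (by rw [map_mul, map_mul, mul_comm])

end Conjugation

namespace RegularEmbedding

variable {K E : Type*} [Field K] [Field E] [Algebra K E] [FiniteDimensional K E]
  {L : IntermediateField K E} {N : Type*} [Group N]

/-- The homomorphism `β̄ : Gal(E/K) → Aut(N)` obtained from `α` by Byott's translation. When `E`
is the normal closure of `L`, it is `α.byott.autPart`. -/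
def translateAutPart (α : RegularEmbedding L N) : Gal(E/K) →* MulAut N :=
  (holProj N).comp α.translateHom

/-- The isomorphism `N ≃* α(N)`. -/
def rangeEquiv (α : RegularEmbedding L N) : N ≃* α.toHom.range :=
  MonoidHom.ofInjective α.injective

theorem rangeEquiv_translateAutPart (α : RegularEmbedding L N) (σ : Gal(E/K)) (n : N) :
    α.rangeEquiv (α.translateAutPart σ n) = α.conjAction σ (α.rangeEquiv n) := by
  let β : Equiv.Perm N := α.translateHom σ
  have intertwine : α.toHom (α.translateAutPart σ n) * lam L σ = lam L σ * α.toHom n := by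
    refine Equiv.ext fun x => ?_
    obtain ⟨y, rfl⟩ := α.orbitEquiv.surjective x
    calc α.toHom (α.translateAutPart σ n) (lam L σ (α.orbitEquiv y))
      _ = α.toHom (α.translateAutPart σ n) (α.orbitEquiv (β y)) := by
        rw [orbitEquiv_translateHom]
      _ = α.orbitEquiv (α.translateAutPart σ n * β y) := (orbitEquiv_mul ..).symm
      _ = α.orbitEquiv (β (n * y)) :=
        congrArg _ (apply_mul_of_mem_Hol (α.translateHom σ).2 n y).symm
      _ = lam L σ (α.orbitEquiv (n * y)) := orbitEquiv_translateHom ..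
      _ = lam L σ (α.toHom n (α.orbitEquiv y)) := by rw [orbitEquiv_mul]
  exact Subtype.ext <|
    (eq_mul_inv_of_mul_eq intertwine).trans (coe_conjAction α σ (α.rangeEquiv n)).symm

theorem nonempty_hopfAlgebra_equiv_iff [IsGalois K E] (α₁ α₂ : RegularEmbedding L N) :
    Nonempty (α₁.hopfAlgebra ≃ₐc[K] α₂.hopfAlgebra) ↔
      ∃ μ : MulAut N, ∀ g, α₂.translateAutPart g = μ * α₁.translateAutPart g * μ⁻¹ := by
  rw [nonempty_fixedAlgebra_equiv_iff_exists_mulEquiv]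
  exact exists_equivariant_mulEquiv_iff α₁.rangeEquiv α₂.rangeEquiv
    α₁.rangeEquiv_translateAutPart α₂.rangeEquiv_translateAutPart

end RegularEmbedding

end HopfGalois

end

theorem mainTheorem3_general {K E : Type*} [Field K] [Field E] [Algebra K E]
    [FiniteDimensional K E] [IsGalois K E] (L : IntermediateField K E)
    {N : Type*} [Group N] (α₁ α₂ : HopfGalois.RegularEmbedding L N) :
    (Nonempty (α₁.hopfAlgebra ≃ₐc[K] α₂.hopfAlgebra) ↔
      ∃ μ : MulAut N, ∀ g : Gal(E/K),
        α₂.translateAutPart g = μ * α₁.translateAutPart g * μ⁻¹) ∧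
    ((∀ φ ψ : MulAut N, φ * ψ = ψ * φ) →
      (Nonempty (α₁.hopfAlgebra ≃ₐc[K] α₂.hopfAlgebra) ↔
        ∀ g : Gal(E/K), α₁.translateAutPart g = α₂.translateAutPart g)) ∧
    (IsCyclic N →
      (Nonempty (α₁.hopfAlgebra ≃ₐc[K] α₂.hopfAlgebra) ↔
        ∀ g : Gal(E/K), α₁.translateAutPart g = α₂.translateAutPart g)) := by
  have conj_iff := HopfGalois.RegularEmbedding.nonempty_hopfAlgebra_equiv_iff α₁ α₂
  have eq_iff (hcomm : ∀ φ ψ : MulAut N, φ * ψ = ψ * φ) :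
      Nonempty (α₁.hopfAlgebra ≃ₐc[K] α₂.hopfAlgebra) ↔
        ∀ g, α₁.translateAutPart g = α₂.translateAutPart g :=
    conj_iff.trans (HopfGalois.exists_conj_iff_of_mul_comm hcomm)
  exact ⟨conj_iff, eq_iff, fun _ => eq_iff HopfGalois.mulAut_mul_comm_of_isCyclic⟩

theorem mainTheorem3 {K E : Type*} [Field K] [Field E] [Algebra K E]
    [FiniteDimensional K E] [IsGalois K E]
    (L : IntermediateField K E) [IsNormalClosure K L E]
    {N : Type*} [Group N] (α₁ α₂ : HopfGalois.RegularEmbedding L N) :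
    (Nonempty (α₁.hopfAlgebra ≃ₐc[K] α₂.hopfAlgebra) ↔
      ∃ μ : MulAut N, ∀ g : Gal(E/K),
        α₂.byott.autPart g = μ * α₁.byott.autPart g * μ⁻¹) ∧
    ((∀ φ ψ : MulAut N, φ * ψ = ψ * φ) →
      (Nonempty (α₁.hopfAlgebra ≃ₐc[K] α₂.hopfAlgebra) ↔
        ∀ g : Gal(E/K), α₁.byott.autPart g = α₂.byott.autPart g)) ∧
    (IsCyclic N →
      (Nonempty (α₁.hopfAlgebra ≃ₐc[K] α₂.hopfAlgebra) ↔
        ∀ g : Gal(E/K), α₁.byott.autPart g = α₂.byott.autPart g)) :=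
  mainTheorem3_general L α₁ α₂
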